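/- **Setting.** For every sample size $n$ let $p=p_n$ and let $(\Omega_{X_1},d_{X_1}),\dots,(\Omega_{X_p},d_{X_p})$ be separable metric spaces and $(\Omega_Y,d_Y)$ a metric space, all with their Borel $\sigma$-fields. Let $\mathcal M_j$ be the real reproducing kernel Hilbert space of a positive definite kernel $\kappa_j$ on $\Omega_{X_j}$, such that $x\mapsto(\kappa_1(\cdot,x_1),\dots,\kappa_p(\cdot,x_p))$ is strongly measurable up to null sets. Let $(X_1,Y_1),\dots,(X_n,Y_n)$, $X_i=(X_{i1},\dots,X_{ip})$, be i.i.d. copies of $(X,Y)\in\prod_j\Omega_{X_j}\times\Omega_Y$. Fix $y,y_0\in\Omega_Y$, put $U(y)=d_Y^2(Y,y)-d_Y^2(Y,y_0)$ and $U_i(y)=d_Y^2(Y_i,y)-d_Y^2(Y_i,y_0)$, and suppose $$U(y)=\sum_{j=1}^p f_j(X_j)+\epsilon,\qquad f_j\in\mathcal M_j,\quad \mathbb E[\epsilon\mid X]=0,\quad \mathbb E[\epsilon^2]<\infty .$$ Write $\boldsymbol f_0=(f_1,\dots,f_p)$, $S_0=\{j: f_j\neq 0\}$, $s_0=|S_0|$.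 All spaces, the law of $(X,Y)$, $y$, $y_0$, $\boldsymbol f_0$, $S_0$, $p$, $\lambda_1$, $\lambda_2$ may depend on $n$; the constants $\gamma,C,B,c,s$ below do not. For $\lambda_1,\lambda_2>0$ let $\hat{\boldsymbol f}=(\hat f_1,\dots,\hat f_p)$ be a minimizer over $\prod_j\mathcal M_j$ of $$\frac1{2n}\sum_{i=1}^n\Big(U_i(y)-\sum_{j=1}^p g_j(X_{ij})\Big)^2+\lambda_1\sum_{j=1}^p\|g_j\|_{\mathcal M_j}+\frac{\lambda_2}2\sum_{j=1}^p\|g_j\|_{\mathcal M_j}^2,$$ and $\hat S=\{j:\hat f_j\ne0\}$. Let $\Sigma=\mathbb E[\Phi\otimes\Phi]$, $\Phi=(\kappa_1(\cdot,X_1),\dots,\kappa_p(\cdot,X_p))$, be the (uncentered) covariance operator on the Hilbert direct sum $\bigoplus_j\mathcal M_j$, with sub-operators $\Sigma_{S_1S_2}:\bigoplus_{k\in S_2}\mathcal M_k\to\bigoplus_{j\in S_1}\mathcal M_j$ and $\Sigma_{jj}=\Sigma_{\{j\}\{j\}}$. For $T:\bigoplus_{k\in S_2}\mathcal M_k\to\bigoplus_{j\in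 S_1}\mathcal M_j$ put $$\|T\|_{\infty,\infty}=\sup\Big\{\langle g,Th\rangle:\ \max_{j\in S_1}\|g_j\|_{\mathcal M_j}\le1,\ \max_{k\in S_2}\|h_k\|_{\mathcal M_k}\le1\Big\}.$$ **Theorem.** Assume that there are constants $\gamma>0$, $C>1$, $B$, $c>0$ and $s\in\mathbb N$ such that: 1. (Irrepresentable) $\|\Sigma_{S_0^cS_0}(\Sigma_{S_0S_0}+\lambda_2I)^{-1}\|_{\infty,\infty}<1-\gamma$ for all $n$; 2. (Tuning) $\lambda_1/\lambda_2>C(1-\gamma)/\gamma$ for all $n$, $\sqrt n\,\lambda_2^2/p\to\infty$ and $\lambda_1\to0$; 3. (Boundedness) $\sup_n\|\boldsymbol f_0\|<C$ with the same $C$ as in 2, where $\|\boldsymbol f_0\|^2=\sum_j\|f_j\|^2_{\mathcal M_j}$; and, for all $n$, $\|\kappa_j(\cdot,x_j)\|_{\mathcal M_j}\le B$ for all $j$ and $x_j\in\Omega_{X_j}$, and $\mathbb E[\epsilon^2]\le B$; 4. (Dimensionality) $p=o(\sqrt n)$, and $s_0\le s$ for all $n$; 5. (Signal strength) $\mathbb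 E[f_j^2(X_j)]>c$ for all $j\in S_0$ and all $n$; 6. (Regularization scaling) $\lambda_1\,\|\mathrm{diag}(\Sigma_{jj}:j\in S_0)\,(\Sigma_{S_0S_0}+\lambda_2I)^{-1}\|_{\infty,\infty}\to0$. Then, as $n\to\infty$, $$\mathbb P(\hat S=S_0)\to1\qquad\text{and}\qquad \sup_{j\in S_0}\|\Sigma_{jj}(\hat f_j-f_j)\|_{\mathcal M_j}=o_p(1).$$ -/

import Mathlib

open MeasureTheory ProbabilityTheory Filter Topology Asymptotics

noncomputable section

namespace FrechetEnet

section Operators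

variable {ι : Type*} [Fintype ι] {M : ι → Type*} [∀ j, NormedAddCommGroup (M j)]
  [∀ j, InnerProductSpace ℝ (M j)]

/-- Coordinate restriction `(f_j)_j ↦ (f_j)_{j ∈ S}` on the Hilbert direct sum `⨁_j M_j`. -/
def restrictTo (S : Finset ι) : PiLp 2 M →L[ℝ] PiLp 2 (fun j : S => M j) :=
  (PiLp.continuousLinearEquiv 2 ℝ (fun j : S => M j)).symm.toContinuousLinearMap ∘L
    ContinuousLinearMap.pi fun j : S => PiLp.proj 2 M (j : ι)

open Classical in
/-- Extension by zero of `(f_j)_{j ∈ S}` to an element of `⨁_j M_j`. -/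
def extendZero (S : Finset ι) : PiLp 2 (fun j : S => M j) →L[ℝ] PiLp 2 M :=
  (PiLp.continuousLinearEquiv 2 ℝ M).symm.toContinuousLinearMap ∘L
    ContinuousLinearMap.pi fun j : ι =>
      if h : j ∈ S then PiLp.proj 2 (fun j : S => M j) ⟨j, h⟩ else 0

/-- The sub-operator `T_{S₁ S₂}` of an operator `T` on `⨁_j M_j`. -/
def subOp (T : PiLp 2 M →L[ℝ] PiLp 2 M) (S₁ S₂ : Finset ι) :
    PiLp 2 (fun j : S₂ => M j) →L[ℝ] PiLp 2 (fun j : S₁ => M j) :=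
  restrictTo S₁ ∘L T ∘L extendZero S₂

open Classical in
/-- The diagonal block `T_{jj} : M_j → M_j` of an operator `T` on `⨁_j M_j`. -/
def diagBlock (T : PiLp 2 M →L[ℝ] PiLp 2 M) (j : ι) : M j →L[ℝ] M j :=
  PiLp.proj 2 M j ∘L T ∘L
    (PiLp.continuousLinearEquiv 2 ℝ M).symm.toContinuousLinearMap ∘L
      ContinuousLinearMap.single ℝ M j

/-- The block-diagonal operator `diag(T_{jj} : j ∈ S)` on `⨁_{j ∈ S} M_j`. -/
def diagOp (T : PiLp 2 M →L[ℝ] PiLp 2 M) (S : Finset ι) :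
    PiLp 2 (fun j : S => M j) →L[ℝ] PiLp 2 (fun j : S => M j) :=
  (PiLp.continuousLinearEquiv 2 ℝ (fun j : S => M j)).symm.toContinuousLinearMap ∘L
    ContinuousLinearMap.pi fun j : S =>
      diagBlock T (j : ι) ∘L PiLp.proj 2 (fun j : S => M j) j

/-- The regularized inverse `(T_{SS} + lam I)⁻¹`. (`Ring.inverse` is the two-sided inverse in the
algebra of bounded operators whenever there is one; this is the case for positive semidefinite
`T` and `lam > 0`.) -/
def regInverse (T : PiLp 2 M →L[ℝ] PiLp 2 M) (S : Finset ι) (lam : ℝ) :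
    PiLp 2 (fun j : S => M j) →L[ℝ] PiLp 2 (fun j : S => M j) :=
  Ring.inverse (subOp T S S + lam • (1 : PiLp 2 (fun j : S => M j) →L[ℝ] _))

/-- The `(∞, ∞)`-norm: the supremum of `⟨f₁, T f₂⟩` over all `f₁`, `f₂` with
`max_j ‖f₁ⱼ‖ ≤ 1` and `max_k ‖f₂ₖ‖ ≤ 1`. -/
def normInfInf {S₁ S₂ : Finset ι}
    (T : PiLp 2 (fun j : S₂ => M j) →L[ℝ] PiLp 2 (fun j : S₁ => M j)) : ℝ :=
  sSup {r : ℝ | ∃ (f₁ : PiLp 2 (fun j : S₁ => M j)) (f₂ : PiLp 2 (fun j : S₂ => M j)),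
    (∀ j, ‖f₁ j‖ ≤ 1) ∧ (∀ k, ‖f₂ k‖ ≤ 1) ∧ r = inner ℝ f₁ (T f₂)}

open Classical in
/-- The set of nonzero components of `f = (f_j)_j`. -/
def activeSet (f : PiLp 2 M) : Finset ι := Finset.univ.filter fun j => f j ≠ 0

end Operators

section Model

variable {ι : Type*} [Fintype ι] {𝒳 : ι → Type*} {M : ι → Type*} {𝒴 : Type*}
  [∀ j, NormedAddCommGroup (M j)] [∀ j, InnerProductSpace ℝ (M j)] [∀ j, CompleteSpace (M j)]
  [∀ j, RKHS ℝ (M j) (𝒳 j) ℝ]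

variable (M) in
/-- The joint feature map `x ↦ (κ_1(·, x_1), …, κ_p(·, x_p))`, where `κ_j` is the reproducing
kernel of `M_j`: the `j`-th entry is the element `κ_j(·, x_j)` of `M_j`. -/
def feature (x : ∀ j, 𝒳 j) : PiLp 2 M :=
  WithLp.toLp 2 fun j => RKHS.kerFun (M j) (x j) (1 : ℝ)

variable (M) in
/-- The population covariance operator
`Σ = E[(κ_1(·, X_1), …, κ_p(·, X_p)) ⊗ (κ_1(·, X_1), …, κ_p(·, X_p))]` for `X ∼ ν`. -/
def covOp [∀ j, MeasurableSpace (𝒳 j)] (ν : Measure (∀ j, 𝒳 j)) : PiLp 2 M →L[ℝ] PiLp 2 M :=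
  ∫ x, InnerProductSpace.rankOne ℝ (feature M x) (feature M x) ∂ν

/-- The transformed response `U(y) = d²(Y, y) - d²(Y, y₀)` at `Y = y'`. -/
def response [MetricSpace 𝒴] (y y₀ y' : 𝒴) : ℝ := dist y' y ^ 2 - dist y' y₀ ^ 2

/-- The error `ε = U(y) - ∑_j f_j(X_j)` of the additive model, at `(X, Y) = z`. -/
def modelError [MetricSpace 𝒴] (y y₀ : 𝒴) (f : PiLp 2 M) (z : (∀ j, 𝒳 j) × 𝒴) : ℝ :=
  response y y₀ z.2 - ∑ j, (f j) (z.1 j)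

/-- The elastic-net objective for the sample `z 0, …, z (n-1)`. -/
def enetObjective [MetricSpace 𝒴] {n : ℕ} (y y₀ : 𝒴) (lam₁ lam₂ : ℝ)
    (z : Fin n → (∀ j, 𝒳 j) × 𝒴) (f : PiLp 2 M) : ℝ :=
  1 / (2 * (n : ℝ)) * ∑ i, (response y y₀ (z i).2 - ∑ j, (f j) ((z i).1 j)) ^ 2
    + lam₁ * ∑ j, ‖f j‖ + lam₂ / 2 * ∑ j, ‖f j‖ ^ 2

end Model

end FrechetEnet


end

open FrechetEnet

/-! The objective depends on the sample only through the vectors `feature` at the data points, so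
the problem is a group elastic net in a Hilbert direct sum. Write `l`, `L` for the ridge and lasso
parameters, `Δ` for the estimation error and `q` for the negative gradient of the smooth part at the
minimizer. Stationarity gives `‖q j‖ ≤ L` and `⟨q j, g j⟩ = L * ‖g j‖`, and the normal equations
become `T Δ + l Δ = b - q - l f` with `T` the population covariance. Here `b` is the empirical noise
minus `(empCov a - T) Δ`. A crude energy bound on `l * ‖Δ‖` makes `‖b‖` of size `l * ρ` with `ρ →
0`, once the noise and the covariance deviation are at most `l ^ 2`.

No restricted (oracle) problem is solved. In `error_eq_zero_of_notMem` the equation is tested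
against the Schur-complement vector built from the inactive part of `Δ`. Positivity and the
irrepresentable condition then force that part to vanish. What remains is inverted on the active
block, and `norm_diagBlock_error_le` bounds `Σ_jj Δ_j`. An active component estimated as zero would
contradict `c < E[f_j²] = ⟨f_j, Σ_jj f_j⟩`.

Probability enters only through Chebyshev's inequality in a Hilbert space, at threshold `l ^ 2`. The
failure probability is of order `p² / (n l⁴)`, which tends to zero by the tuning condition. -/

noncomputable section

namespace FrechetEnet

set_option linter.unusedSectionVars false

/-! ### Block operators, the (∞, ∞)-norm and regularized inverses. -/

section Operators

variable {ι : Type*} [Fintype ι] {M : ι → Type*} [∀ j, NormedAddCommGroup (M j)]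
  [∀ j, InnerProductSpace ℝ (M j)]

lemma restrictTo_apply (S : Finset ι) (v : PiLp 2 M) (j : S) : restrictTo S v j = v j := rfl

lemma extendZero_apply_of_mem {S : Finset ι} (v : PiLp 2 (fun j : S => M j)) {j : ι}
    (hj : j ∈ S) : extendZero S v j = v ⟨j, hj⟩ := by
  simp [extendZero, hj]

lemma extendZero_apply_of_notMem {S : Finset ι} (v : PiLp 2 (fun j : S => M j)) {j : ι}
    (hj : j ∉ S) : extendZero S v j = 0 := by
  simp [extendZero, hj]

lemma restrictTo_extendZero (S : Finset ι) (v : PiLp 2 (fun j : S => M j)) :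
    restrictTo S (extendZero S v) = v := by
  ext j
  rw [restrictTo_apply, extendZero_apply_of_mem v j.2]

lemma inner_extendZero_left (S : Finset ι) (v : PiLp 2 (fun j : S => M j)) (u : PiLp 2 M) :
    inner ℝ (extendZero S v) u = inner ℝ v (restrictTo S u) := by
  classical
  simp only [PiLp.inner_apply, restrictTo_apply]
  rw [← Finset.sum_subset (Finset.subset_univ S)
    (fun j _ hj => by rw [extendZero_apply_of_notMem v hj, inner_zero_left]),
    ← Finset.sum_coe_sort S]
  exact Finset.sum_congr rfl fun j _ => by rw [extendZero_apply_of_mem v j.2]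

lemma inner_extendZero_right (S : Finset ι) (v : PiLp 2 (fun j : S => M j)) (u : PiLp 2 M) :
    inner ℝ u (extendZero S v) = inner ℝ (restrictTo S u) v := by
  rw [real_inner_comm, inner_extendZero_left, real_inner_comm]

lemma extendZero_restrictTo_of_support {S : Finset ι} {v : PiLp 2 M}
    (hv : ∀ j, j ∉ S → v j = 0) : extendZero S (restrictTo S v) = v := by
  ext j
  by_cases hj : j ∈ S
  · rw [extendZero_apply_of_mem _ hj, restrictTo_apply]
  · rw [extendZero_apply_of_notMem _ hj, hv j hj]

lemma extendZero_add_extendZero_compl [DecidableEq ι] (S : Finset ι) (v : PiLp 2 M) :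
    extendZero S (restrictTo S v) + extendZero Sᶜ (restrictTo Sᶜ v) = v := by
  ext j
  by_cases hj : j ∈ S
  · have hj' : j ∉ Sᶜ := by simpa using hj
    rw [PiLp.add_apply, extendZero_apply_of_mem _ hj, extendZero_apply_of_notMem _ hj',
      restrictTo_apply, add_zero]
  · have hj' : j ∈ Sᶜ := by simpa using hj
    rw [PiLp.add_apply, extendZero_apply_of_mem _ hj', extendZero_apply_of_notMem _ hj,
      restrictTo_apply, zero_add]

lemma subOp_apply (T : PiLp 2 M →L[ℝ] PiLp 2 M) (S₁ S₂ : Finset ι)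
    (v : PiLp 2 (fun j : S₂ => M j)) : subOp T S₁ S₂ v = restrictTo S₁ (T (extendZero S₂ v)) := rfl

lemma diagOp_apply (T : PiLp 2 M →L[ℝ] PiLp 2 M) (S : Finset ι)
    (v : PiLp 2 (fun j : S => M j)) (j : S) : diagOp T S v j = diagBlock T j (v j) := rfl

open Classical in
lemma inner_diagBlock (T : PiLp 2 M →L[ℝ] PiLp 2 M) (j : ι) (a b : M j) :
    inner ℝ a (diagBlock T j b) = inner ℝ (WithLp.toLp 2 (Pi.single j a) : PiLp 2 M)
      (T (WithLp.toLp 2 (Pi.single j b))) := by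
  rw [PiLp.inner_apply, Finset.sum_eq_single j]
  · simp [diagBlock]
  · intro k _ hk
    simp [Pi.single_eq_of_ne hk]
  · simp

section normInfInf

variable {S₁ S₂ : Finset ι} (A : PiLp 2 (fun j : S₂ => M j) →L[ℝ] PiLp 2 (fun j : S₁ => M j))

/-- There are finitely many blocks, so the sup-norm unit balls are bounded in Hilbert norm. This
makes the `sSup` a genuine supremum and not the default value of an unbounded set. -/
lemma bddAbove_normInfInf :
    BddAbove {r : ℝ | ∃ (f₁ : PiLp 2 (fun j : S₁ => M j)) (f₂ : PiLp 2 (fun j : S₂ => M j)),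
      (∀ j, ‖f₁ j‖ ≤ 1) ∧ (∀ k, ‖f₂ k‖ ≤ 1) ∧ r = inner ℝ f₁ (A f₂)} := by
  have key : ∀ (S : Finset ι) (v : PiLp 2 (fun j : S => M j)), (∀ j, ‖v j‖ ≤ 1) →
      ‖v‖ ≤ √(Fintype.card S) := by
    intro S v hv
    rw [PiLp.norm_eq_of_L2]
    refine Real.sqrt_le_sqrt ?_
    calc ∑ j, ‖v j‖ ^ 2 ≤ ∑ _j : S, (1 : ℝ) :=
          Finset.sum_le_sum fun j _ => pow_le_one₀ (norm_nonneg _) (hv j)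
      _ = _ := by simp
  refine ⟨√(Fintype.card S₁) * (‖A‖ * √(Fintype.card S₂)), ?_⟩
  rintro r ⟨f₁, f₂, h₁, h₂, rfl⟩
  refine (real_inner_le_norm _ _).trans ?_
  gcongr
  · exact key _ _ h₁
  · exact (A.le_opNorm f₂).trans (by gcongr; exact key _ _ h₂)

lemma normInfInf_nonneg : 0 ≤ normInfInf A :=
  le_csSup (bddAbove_normInfInf A) ⟨0, 0, by simp, by simp, by simp⟩

lemma inner_le_normInfInf_mul {g : PiLp 2 (fun j : S₁ => M j)} {v : PiLp 2 (fun j : S₂ => M j)}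
    {a b : ℝ} (ha : 0 ≤ a) (hb : 0 ≤ b) (hg : ∀ j, ‖g j‖ ≤ a) (hv : ∀ k, ‖v k‖ ≤ b) :
    inner ℝ g (A v) ≤ normInfInf A * a * b := by
  rcases ha.eq_or_lt with rfl | ha
  · have : g = 0 := by ext j; simpa using hg j
    simp [this]
  rcases hb.eq_or_lt with rfl | hb
  · have : v = 0 := by ext j; simpa using hv j
    simp [this]
  have h : inner ℝ (a⁻¹ • g) (A (b⁻¹ • v)) ≤ normInfInf A := by
    refine le_csSup (bddAbove_normInfInf A) ⟨_, _, fun j => ?_, fun k => ?_, rfl⟩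
    · rw [PiLp.smul_apply, norm_smul, norm_inv, Real.norm_of_nonneg ha.le, inv_mul_le_one₀ ha]
      exact hg j
    · rw [PiLp.smul_apply, norm_smul, norm_inv, Real.norm_of_nonneg hb.le, inv_mul_le_one₀ hb]
      exact hv k
  rw [map_smul, real_inner_smul_left, real_inner_smul_right] at h
  calc inner ℝ g (A v) = (a⁻¹ * (b⁻¹ * inner ℝ g (A v))) * a * b := by field_simp
    _ ≤ _ := by gcongr

lemma norm_apply_le_normInfInf_mul {v : PiLp 2 (fun j : S₂ => M j)} {b : ℝ} (hb : 0 ≤ b)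
    (hv : ∀ k, ‖v k‖ ≤ b) (j : S₁) : ‖A v j‖ ≤ normInfInf A * b := by
  classical
  rcases (norm_nonneg (A v j)).eq_or_lt with h | h
  · rw [← h]; exact mul_nonneg (normInfInf_nonneg A) hb
  -- Duality: the test vector carries `A v j` in block `j` and zero elsewhere.
  have key := inner_le_normInfInf_mul A (g := WithLp.toLp 2 (Pi.single j (A v j))) h.le hb
    (fun k => by
      by_cases hk : k = j
      · subst hk; simp
      · simp [Pi.single_eq_of_ne hk]) hv
  rw [PiLp.inner_apply, Finset.sum_eq_single j
    (fun k _ hk => by simp [Pi.single_eq_of_ne hk]) (by simp)] at key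
  simp only [Pi.single_eq_same, real_inner_self_eq_norm_sq] at key
  refine le_of_mul_le_mul_left ?_ h
  linarith [key]

end normInfInf

section Regularized

variable [∀ j, CompleteSpace (M j)] {T : PiLp 2 M →L[ℝ] PiLp 2 M}

/-- Coercivity: the quadratic form dominates `l * ‖x‖ ^ 2`. Hence `Ring.inverse` in `regInverse` is
a true inverse. -/
lemma isUnit_subOp_add (hpos : ∀ u, 0 ≤ inner ℝ (T u) u) (S : Finset ι) {l : ℝ} (hl : 0 < l) :
    IsUnit (subOp T S S + l • (1 : PiLp 2 (fun j : S => M j) →L[ℝ] _)) := by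
  refine ContinuousLinearMap.isUnit_of_forall_le_norm_inner_map _ (c := ⟨l, hl.le⟩) hl fun x => ?_
  have h : inner ℝ (subOp T S S x + l • x) x =
      inner ℝ (T (extendZero S x)) (extendZero S x) + l * ‖x‖ ^ 2 := by
    simp [inner_add_left, subOp_apply, inner_extendZero_right, real_inner_smul_left]
  change _ ≤ ‖inner ℝ (subOp T S S x + l • x) x‖
  rw [h, Real.norm_eq_abs]
  refine le_trans ?_ (le_abs_self _)
  have := hpos (extendZero S x)
  change ‖x‖ ^ 2 * l ≤ _
  linarith

lemma subOp_add_regInverse_apply (hpos : ∀ u, 0 ≤ inner ℝ (T u) u) (S : Finset ι) {l : ℝ}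
    (hl : 0 < l) (v : PiLp 2 (fun j : S => M j)) :
    subOp T S S (regInverse T S l v) + l • regInverse T S l v = v :=
  DFunLike.congr_fun (Ring.mul_inverse_cancel _ (isUnit_subOp_add hpos S hl)) v

lemma regInverse_subOp_add_apply (hpos : ∀ u, 0 ≤ inner ℝ (T u) u) (S : Finset ι) {l : ℝ}
    (hl : 0 < l) (v : PiLp 2 (fun j : S => M j)) :
    regInverse T S l (subOp T S S v + l • v) = v :=
  DFunLike.congr_fun (Ring.inverse_mul_cancel _ (isUnit_subOp_add hpos S hl)) v

lemma inner_subOp_comm (hsymm : ∀ u v, inner ℝ (T u) v = inner ℝ u (T v)) (S₁ S₂ : Finset ι)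
    (u : PiLp 2 (fun j : S₂ => M j)) (v : PiLp 2 (fun j : S₁ => M j)) :
    inner ℝ (subOp T S₁ S₂ u) v = inner ℝ u (subOp T S₂ S₁ v) := by
  rw [subOp_apply, subOp_apply, ← inner_extendZero_right, hsymm, inner_extendZero_left]

lemma inner_regInverse_comm (hsymm : ∀ u v, inner ℝ (T u) v = inner ℝ u (T v))
    (hpos : ∀ u, 0 ≤ inner ℝ (T u) u) (S : Finset ι) {l : ℝ} (hl : 0 < l)
    (u v : PiLp 2 (fun j : S => M j)) :
    inner ℝ (regInverse T S l u) v = inner ℝ u (regInverse T S l v) := by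
  conv_lhs => rw [← subOp_add_regInverse_apply hpos S hl v]
  conv_rhs => rw [← subOp_add_regInverse_apply hpos S hl u]
  rw [inner_add_left, inner_add_right, inner_subOp_comm hsymm, real_inner_smul_left,
    real_inner_smul_right]

end Regularized

end Operators

/-! ### Deterministic consequences of the stationarity equation. -/

section Deterministic

variable {ι : Type*} [Fintype ι] {M : ι → Type*} [∀ j, NormedAddCommGroup (M j)]
  [∀ j, InnerProductSpace ℝ (M j)] {T : PiLp 2 M →L[ℝ] PiLp 2 M}
  {S : Finset ι} {l L B r : ℝ} {Δ b q f : PiLp 2 M}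

lemma norm_score_apply_le (hl : 0 < l) (hq : ∀ j, ‖q j‖ ≤ L) (hb : ‖b‖ ≤ r)
    (hf : ‖f‖ ≤ B) (j : ι) : ‖(b - q - l • f) j‖ ≤ r + L + l * B := by
  have h1 : ‖b j‖ ≤ r := (PiLp.norm_apply_le b j).trans hb
  have h2 : ‖f j‖ ≤ B := (PiLp.norm_apply_le f j).trans hf
  calc ‖(b - q - l • f) j‖ = ‖b j - q j - l • f j‖ := rfl
    _ ≤ ‖b j‖ + ‖q j‖ + ‖l • f j‖ := (norm_sub_le _ _).trans (by gcongr; exact norm_sub_le _ _)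
    _ ≤ r + L + l * B := by
      rw [norm_smul, Real.norm_of_nonneg hl.le]
      gcongr
      exact hq j

/-- A crude bound on the estimation error that does not involve the number of inactive
components. -/
lemma mul_norm_error_le (hpos : ∀ u, 0 ≤ inner ℝ (T u) u) {s : ℕ} (hs : S.card ≤ s)
    (hl : 0 < l) (hL : 0 ≤ L) (hq : ∀ j, ‖q j‖ ≤ L) (hb : ‖b‖ ≤ r) (hf : ‖f‖ ≤ B)
    (hqΔ : ∀ j, j ∉ S → 0 ≤ inner ℝ (q j) (Δ j))
    (heq : T Δ + l • Δ = b - q - l • f) : l * ‖Δ‖ ≤ r + s * L + l * B := by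
  classical
  rcases (norm_nonneg Δ).eq_or_lt with h0 | h0
  · have hr := (norm_nonneg b).trans hb
    have hB := (norm_nonneg f).trans hf
    rw [← h0, mul_zero]
    positivity
  -- Inactive terms have the favourable sign, so only the at most `s` active ones cost anything.
  have hqsum : -(s * L * ‖Δ‖) ≤ inner ℝ q Δ := by
    rw [PiLp.inner_apply, ← Finset.sum_add_sum_compl S]
    have h1 : 0 ≤ ∑ j ∈ Sᶜ, inner ℝ (q j) (Δ j) :=
      Finset.sum_nonneg fun j hj => hqΔ j (by simpa using hj)
    have h2 : ∑ _j ∈ S, -(L * ‖Δ‖) ≤ ∑ j ∈ S, inner ℝ (q j) (Δ j) := by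
      refine Finset.sum_le_sum fun j _ => ?_
      refine le_trans ?_ (neg_le_of_abs_le (abs_real_inner_le_norm (q j) (Δ j)))
      have := mul_le_mul (hq j) (PiLp.norm_apply_le Δ j) (norm_nonneg _) hL
      linarith
    rw [Finset.sum_const, nsmul_eq_mul] at h2
    have h3 : (S.card : ℝ) * (L * ‖Δ‖) ≤ s * (L * ‖Δ‖) := by gcongr
    linarith
  have h := congrArg (fun v => inner ℝ v Δ) heq
  simp only [inner_add_left, inner_sub_left, real_inner_smul_left,
    real_inner_self_eq_norm_sq] at h
  have hb' : inner ℝ b Δ ≤ r * ‖Δ‖ := (real_inner_le_norm _ _).trans (by gcongr)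
  have hf' : -(B * ‖Δ‖) ≤ inner ℝ f Δ :=
    le_trans (neg_le_neg (by gcongr)) (neg_le_of_abs_le (abs_real_inner_le_norm f Δ))
  have hf'' := mul_le_mul_of_nonneg_left hf' hl.le
  have hT := hpos Δ
  refine le_of_mul_le_mul_right ?_ h0
  nlinarith

variable [∀ j, CompleteSpace (M j)]

/-- Support recovery: under the irrepresentable condition for `T`, a solution of the stationarity
equations vanishes off `S`. -/
lemma error_eq_zero_of_notMem [DecidableEq ι]
    (hsymm : ∀ u v, inner ℝ (T u) v = inner ℝ u (T v)) (hpos : ∀ u, 0 ≤ inner ℝ (T u) u)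
    (hl : 0 < l) (hL : 0 ≤ L) {κ : ℝ}
    (hκ : normInfInf (subOp T Sᶜ S ∘L regInverse T S l) ≤ κ)
    (hq : ∀ j, ‖q j‖ ≤ L) (hb : ‖b‖ ≤ r) (hf : ‖f‖ ≤ B) (hfS : ∀ j, j ∉ S → f j = 0)
    (hqΔ : ∀ j, j ∉ S → inner ℝ (q j) (Δ j) = L * ‖Δ j‖)
    (heq : T Δ + l • Δ = b - q - l • f) (hslack : r + κ * (r + L + l * B) < L)
    {j : ι} (hj : j ∉ S) : Δ j = 0 := by
  set ρ := b - q - l • f with hρ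
  set d := restrictTo Sᶜ Δ with hd
  set A := subOp T Sᶜ S ∘L regInverse T S l with hA
  set u := regInverse T S l (subOp T S Sᶜ d) with hu
  -- The inactive part of `w` is `d`; its active part `-u` is chosen so that `(T + l) w` vanishes on
  -- `S`, as in a Schur complement.
  set w := extendZero Sᶜ d - extendZero S u with hw
  set D := ∑ k : (Sᶜ : Finset ι), ‖d k‖ with hD
  have hD0 : 0 ≤ D := Finset.sum_nonneg fun _ _ => norm_nonneg _
  have hr : 0 ≤ r := (norm_nonneg b).trans hb
  have hB : 0 ≤ B := (norm_nonneg f).trans hf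
  have hwS : restrictTo S (T w + l • w) = 0 := by
    have h1 : restrictTo S (extendZero Sᶜ d) = 0 := by
      ext k
      rw [restrictTo_apply, extendZero_apply_of_notMem _ (by simp)]
      rfl
    have h2 := subOp_add_regInverse_apply hpos S hl (subOp T S Sᶜ d)
    rw [← hu, subOp_apply] at h2
    rw [hw, map_add, map_smul, map_sub, map_sub, map_sub, h1, restrictTo_extendZero,
      ← subOp_apply T S Sᶜ d, ← h2, zero_sub, smul_neg]
    abel
  -- `Δ - w` is supported on `S`, where `(T + l) w` is zero.
  have hΔw : inner ℝ (T w + l • w) Δ = inner ℝ (T w + l • w) w := by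
    have h1 : Δ = w + extendZero S (restrictTo S Δ + u) := by
      rw [hw, map_add]
      conv_lhs => rw [← extendZero_add_extendZero_compl S Δ]
      rw [← hd]; abel
    conv_lhs => rw [h1]
    rw [inner_add_right, inner_extendZero_right, hwS, inner_zero_left, add_zero]
  have hnonneg : 0 ≤ inner ℝ w ρ := by
    have h1 : inner ℝ w ρ = inner ℝ (T w + l • w) Δ := by
      rw [← heq, inner_add_left, inner_add_right, hsymm, real_inner_smul_left,
        real_inner_smul_right]
    rw [h1, hΔw, inner_add_left, real_inner_smul_left, real_inner_self_eq_norm_sq]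
    have := hpos w
    positivity
  have hsplit : inner ℝ w ρ = inner ℝ d (restrictTo Sᶜ ρ) - inner ℝ d (A (restrictTo S ρ)) := by
    rw [hw, inner_sub_left, inner_extendZero_left, inner_extendZero_left, hu,
      inner_regInverse_comm hsymm hpos S hl, inner_subOp_comm hsymm]
    rfl
  -- Off `S` the signal is zero and stationarity contributes exactly `-L * ‖d k‖` per block.
  have hfirst : inner ℝ d (restrictTo Sᶜ ρ) ≤ (r - L) * D := by
    rw [PiLp.inner_apply, hD, Finset.mul_sum]
    refine Finset.sum_le_sum fun k _ => ?_
    have hk : (k : ι) ∉ S := Finset.mem_compl.1 k.2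
    have h1 : restrictTo Sᶜ ρ k = b k - q k := by
      rw [restrictTo_apply, hρ]
      simp [hfS k hk]
    have h2 : d k = Δ k := rfl
    rw [h1, h2, inner_sub_right, real_inner_comm (q k), hqΔ k hk]
    have h3 : inner ℝ (Δ k) (b k) ≤ ‖Δ k‖ * r := (real_inner_le_norm _ _).trans
      (by gcongr; exact (PiLp.norm_apply_le b k).trans hb)
    linarith
  -- Each block of `d` is at most the sum `D`, so the (∞, ∞)-norm yields a bound linear in `D`,
  -- comparable with the gain `-L * D`.
  have hsecond : inner ℝ (-d) (A (restrictTo S ρ)) ≤ κ * D * (r + L + l * B) := by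
    refine (inner_le_normInfInf_mul A hD0 (by positivity) (fun k => ?_)
      (fun k => norm_score_apply_le hl hq hb hf k)).trans (by gcongr)
    rw [PiLp.neg_apply, norm_neg]
    exact Finset.single_le_sum (f := fun k => ‖d k‖) (fun _ _ => norm_nonneg _)
      (Finset.mem_univ k)
  rw [inner_neg_left] at hsecond
  have hD' : D = 0 := by
    by_contra hne
    have hDpos : 0 < D := lt_of_le_of_ne hD0 (Ne.symm hne)
    have : 0 < D * (L - r - κ * (r + L + l * B)) := mul_pos hDpos (by linarith)
    nlinarith
  have := (Finset.sum_eq_zero_iff_of_nonneg fun k _ => norm_nonneg (d k)).1 hD'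
    ⟨j, by simpa using hj⟩ (Finset.mem_univ _)
  exact norm_eq_zero.1 this

/-- Once `Δ` is supported on `S`, the `S`-rows of the equation read `Δ_S = (T_SS + l)⁻¹ (b - q - l
f)_S`. -/
lemma norm_diagBlock_error_le (hpos : ∀ u, 0 ≤ inner ℝ (T u) u) (hl : 0 < l) (hL : 0 ≤ L)
    (hq : ∀ j, ‖q j‖ ≤ L) (hb : ‖b‖ ≤ r) (hf : ‖f‖ ≤ B)
    (hΔS : ∀ j, j ∉ S → Δ j = 0) (heq : T Δ + l • Δ = b - q - l • f) (j : S) :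
    ‖diagBlock T j (Δ j)‖ ≤
      normInfInf (diagOp T S ∘L regInverse T S l) * (r + L + l * B) := by
  have hr : 0 ≤ r := (norm_nonneg b).trans hb
  have hB : 0 ≤ B := (norm_nonneg f).trans hf
  have h1 : regInverse T S l (restrictTo S (b - q - l • f)) = restrictTo S Δ := by
    rw [← heq, map_add, map_smul]
    conv_lhs => rw [← extendZero_restrictTo_of_support hΔS, ← subOp_apply, restrictTo_extendZero]
    exact regInverse_subOp_add_apply hpos S hl _
  have h2 := norm_apply_le_normInfInf_mul (diagOp T S ∘L regInverse T S l)
    (v := restrictTo S (b - q - l • f)) (by positivity : 0 ≤ r + L + l * B)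
    (fun k => norm_score_apply_le hl hq hb hf k) j
  rwa [ContinuousLinearMap.comp_apply, h1, diagOp_apply, restrictTo_apply] at h2

end Deterministic

/-! ### Optimality conditions and deterministic recovery. -/

section Stationarity

variable {ι : Type*} [Fintype ι] {M : ι → Type*} [∀ j, NormedAddCommGroup (M j)]
  [∀ j, InnerProductSpace ℝ (M j)]

/-- The empirical second-moment operator of the vectors `a 0, …, a (n-1)`. -/
def empCov {H : Type*} [NormedAddCommGroup H] [InnerProductSpace ℝ H] {n : ℕ} (a : Fin n → H) :
    H →L[ℝ] H :=
  (n : ℝ)⁻¹ • ∑ i, InnerProductSpace.rankOne ℝ (a i) (a i)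

lemma empCov_apply {H : Type*} [NormedAddCommGroup H] [InnerProductSpace ℝ H] {n : ℕ}
    (a : Fin n → H) (v : H) : empCov a v = (n : ℝ)⁻¹ • ∑ i, inner ℝ (a i) v • a i := by
  simp [empCov]

lemma inner_empCov_nonneg {H : Type*} [NormedAddCommGroup H] [InnerProductSpace ℝ H] {n : ℕ}
    (a : Fin n → H) (v : H) : 0 ≤ inner ℝ (empCov a v) v := by
  rw [empCov_apply, real_inner_smul_left, sum_inner]
  refine mul_nonneg (by positivity) (Finset.sum_nonneg fun i _ => ?_)
  rw [real_inner_smul_left]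
  exact mul_self_nonneg _

/-- The elastic-net objective as a function of the feature vectors and the responses. -/
def enetLoss {n : ℕ} (L l : ℝ) (a : Fin n → PiLp 2 M) (u : Fin n → ℝ) (g : PiLp 2 M) : ℝ :=
  1 / (2 * (n : ℝ)) * ∑ i, (u i - inner ℝ (a i) g) ^ 2 + L * ∑ j, ‖g j‖ + l / 2 * ∑ j, ‖g j‖ ^ 2

/-- The negative gradient at `g` of the smooth part of the elastic-net objective. -/
def enetScore {n : ℕ} (l : ℝ) (a : Fin n → PiLp 2 M) (u : Fin n → ℝ) (g : PiLp 2 M) :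
    PiLp 2 M :=
  (n : ℝ)⁻¹ • ∑ i, (u i - inner ℝ (a i) g) • a i - l • g

variable {n : ℕ} {L l : ℝ} {a : Fin n → PiLp 2 M} {u : Fin n → ℝ} {g : PiLp 2 M}

/-- The quadratic terms expand exactly; the lasso penalty is bounded by convexity along the segment,
hence `t ≤ 1`. -/
lemma enetLoss_add_smul_le (hL : 0 ≤ L) (h : PiLp 2 M) {t : ℝ} (ht0 : 0 ≤ t) (ht1 : t ≤ 1) :
    enetLoss L l a u (g + t • h) ≤ enetLoss L l a u g
      + t * (L * ∑ j, (‖g j + h j‖ - ‖g j‖) - inner ℝ (enetScore l a u g) h)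
      + t ^ 2 * (1 / (2 * (n : ℝ)) * ∑ i, inner ℝ (a i) h ^ 2 + l / 2 * ∑ j, ‖h j‖ ^ 2) := by
  have h1 : ∑ i, (u i - inner ℝ (a i) (g + t • h)) ^ 2 = ∑ i, (u i - inner ℝ (a i) g) ^ 2
      - 2 * t * ∑ i, (u i - inner ℝ (a i) g) * inner ℝ (a i) h
      + t ^ 2 * ∑ i, inner ℝ (a i) h ^ 2 := by
    rw [Finset.mul_sum, Finset.mul_sum, ← Finset.sum_sub_distrib, ← Finset.sum_add_distrib]
    refine Finset.sum_congr rfl fun i _ => ?_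
    rw [inner_add_right, real_inner_smul_right]
    ring
  have h2 : ∑ j, ‖(g + t • h) j‖ ^ 2 = ∑ j, ‖g j‖ ^ 2 + 2 * t * inner ℝ g h
      + t ^ 2 * ∑ j, ‖h j‖ ^ 2 := by
    rw [PiLp.inner_apply, Finset.mul_sum, Finset.mul_sum, ← Finset.sum_add_distrib,
      ← Finset.sum_add_distrib]
    refine Finset.sum_congr rfl fun j _ => ?_
    rw [PiLp.add_apply, PiLp.smul_apply, norm_add_sq_real, real_inner_smul_right, norm_smul,
      mul_pow, Real.norm_eq_abs, sq_abs]
    ring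
  have h3 : ∑ j, ‖(g + t • h) j‖ ≤ ∑ j, ‖g j‖ + t * ∑ j, (‖g j + h j‖ - ‖g j‖) := by
    rw [Finset.mul_sum, ← Finset.sum_add_distrib]
    refine Finset.sum_le_sum fun j _ => ?_
    have : (g + t • h) j = (1 - t) • g j + t • (g j + h j) := by
      rw [PiLp.add_apply, PiLp.smul_apply, sub_smul, one_smul, smul_add]
      abel
    rw [this]
    refine (norm_add_le _ _).trans_eq ?_
    rw [norm_smul, norm_smul, Real.norm_of_nonneg ht0, Real.norm_of_nonneg (by linarith)]
    ring
  have h4 : inner ℝ (enetScore l a u g) h =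
      (n : ℝ)⁻¹ * ∑ i, (u i - inner ℝ (a i) g) * inner ℝ (a i) h - l * inner ℝ g h := by
    simp only [enetScore, inner_sub_left, real_inner_smul_left, sum_inner]
  have h5 := mul_le_mul_of_nonneg_left h3 hL
  have h6 : 1 / (2 * (n : ℝ)) = (n : ℝ)⁻¹ / 2 := by
    rw [one_div, mul_inv]; ring
  unfold enetLoss
  rw [h1, h2, h4, h6]
  linarith

/-- Stationarity of a minimizer of the elastic-net objective, in variational form. -/
lemma inner_enetScore_le (hL : 0 ≤ L)
    (hg : ∀ g', enetLoss L l a u g ≤ enetLoss L l a u g') (h : PiLp 2 M) :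
    inner ℝ (enetScore l a u g) h ≤ L * ∑ j, (‖g j + h j‖ - ‖g j‖) := by
  set Q := 1 / (2 * (n : ℝ)) * ∑ i, inner ℝ (a i) h ^ 2 + l / 2 * ∑ j, ‖h j‖ ^ 2 with hQ
  set V := L * ∑ j, (‖g j + h j‖ - ‖g j‖) - inner ℝ (enetScore l a u g) h with hV
  -- Minimality divided by `t`; letting `t → 0+` then removes the second-order term.
  have key : ∀ t : ℝ, t ∈ Set.Ioo (0 : ℝ) 1 → 0 ≤ V + t * Q := by
    intro t ht
    have h1 := (hg (g + t • h)).trans (enetLoss_add_smul_le hL h ht.1.le ht.2.le)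
    rw [← hQ, ← hV] at h1
    refine le_of_mul_le_mul_left ?_ ht.1
    linarith
  have hlim : Tendsto (fun t : ℝ => V + t * Q) (𝓝[>] 0) (𝓝 (V + 0 * Q)) :=
    (Continuous.tendsto (by fun_prop) 0).mono_left nhdsWithin_le_nhds
  have hV0 : 0 ≤ V + 0 * Q := ge_of_tendsto hlim
    (Filter.eventually_of_mem (Ioo_mem_nhdsGT one_pos) key)
  linarith

open Classical in
lemma inner_enetScore_apply_le (hL : 0 ≤ L)
    (hg : ∀ g', enetLoss L l a u g ≤ enetLoss L l a u g') (j : ι) (v : M j) :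
    inner ℝ (enetScore l a u g j) v ≤ L * (‖g j + v‖ - ‖g j‖) := by
  have h := inner_enetScore_le hL hg (WithLp.toLp 2 (Pi.single j v))
  rw [PiLp.inner_apply, Finset.sum_eq_single j, Finset.sum_eq_single j] at h
  · simpa using h
  all_goals simp +contextual [Pi.single_eq_of_ne]

lemma norm_enetScore_apply_le (hL : 0 ≤ L)
    (hg : ∀ g', enetLoss L l a u g ≤ enetLoss L l a u g') (j : ι) :
    ‖enetScore l a u g j‖ ≤ L := by
  set q := enetScore l a u g j with hq
  have h := inner_enetScore_apply_le hL hg j q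
  rw [← hq, real_inner_self_eq_norm_sq] at h
  have h1 : ‖q‖ ^ 2 ≤ L * ‖q‖ := h.trans (by gcongr; linarith [norm_add_le (g j) q])
  rcases (norm_nonneg q).eq_or_lt with h0 | h0
  · rwa [← h0]
  · exact le_of_mul_le_mul_right (by linarith) h0

lemma inner_enetScore_apply_self (hL : 0 ≤ L)
    (hg : ∀ g', enetLoss L l a u g ≤ enetLoss L l a u g') (j : ι) :
    inner ℝ (enetScore l a u g j) (g j) = L * ‖g j‖ := by
  refine le_antisymm ?_ ?_
  · exact (real_inner_le_norm _ _).trans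
      (by gcongr; exact norm_enetScore_apply_le hL hg j)
  · have h := inner_enetScore_apply_le hL hg j (-g j)
    rw [inner_neg_right, add_neg_cancel, norm_zero] at h
    linarith

/-- The normal equations for a candidate `g` in the linear model `u i = ⟨a i, f⟩ + ε i`. -/
lemma empCov_sub_add_smul {f : PiLp 2 M} {ε : Fin n → ℝ} (hu : ∀ i, u i = inner ℝ (a i) f + ε i) :
    empCov a (g - f) + l • (g - f) =
      (n : ℝ)⁻¹ • ∑ i, ε i • a i - enetScore l a u g - l • f := by
  have h : ∀ i, (u i - inner ℝ (a i) g) • a i = ε i • a i - inner ℝ (a i) (g - f) • a i := by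
    intro i
    rw [← sub_smul, hu, inner_sub_right]
    congr 1
    ring
  simp only [enetScore, empCov_apply, h, Finset.sum_sub_distrib, smul_sub]
  abel

variable [∀ j, CompleteSpace (M j)]

/-- Deterministic recovery: when the noise and the covariance deviation are at most `l ^ 2`, the
elastic-net minimizer vanishes off the support and is close to the truth on it. -/
lemma enet_recovery [DecidableEq ι] {T : PiLp 2 M →L[ℝ] PiLp 2 M}
    (hsymm : ∀ u v, inner ℝ (T u) v = inner ℝ u (T v)) (hpos : ∀ u, 0 ≤ inner ℝ (T u) u)
    {S : Finset ι} {s : ℕ} (hs : S.card ≤ s) (hl : 0 < l) (hL : 0 ≤ L) {κ B : ℝ}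
    (hκ : normInfInf (subOp T Sᶜ S ∘L regInverse T S l) ≤ κ)
    {f : PiLp 2 M} (hf : ‖f‖ ≤ B) (hfS : ∀ j, j ∉ S → f j = 0)
    {ε : Fin n → ℝ} (hu : ∀ i, u i = inner ℝ (a i) f + ε i)
    (hg : ∀ g', enetLoss L l a u g ≤ enetLoss L l a u g')
    (hε : ‖(n : ℝ)⁻¹ • ∑ i, ε i • a i‖ ≤ l ^ 2) (hT : ‖empCov a - T‖ ≤ l ^ 2)
    {r : ℝ} (hr : l ^ 2 + l * (l ^ 2 + s * L + l * B) ≤ r)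
    (hslack : r + κ * (r + L + l * B) < L) :
    (∀ j, j ∉ S → g j = 0) ∧ ∀ j : S, ‖diagBlock T j (g j - f j)‖ ≤
      normInfInf (diagOp T S ∘L regInverse T S l) * (r + L + l * B) := by
  have hq := norm_enetScore_apply_le hL hg
  have hΔ : ∀ j, j ∉ S → (g - f) j = g j := fun j hj => by
    rw [PiLp.sub_apply, hfS j hj, sub_zero]
  have hqΔ : ∀ j, j ∉ S →
      inner ℝ (enetScore l a u g j) ((g - f) j) = L * ‖(g - f) j‖ := fun j hj => by
    rw [hΔ j hj, inner_enetScore_apply_self hL hg]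
  have heq := empCov_sub_add_smul (l := l) (g := g) hu
  have hnorm : l * ‖g - f‖ ≤ l ^ 2 + s * L + l * B :=
    mul_norm_error_le (inner_empCov_nonneg a) hs hl hL hq hε hf
      (fun j hj => by rw [hqΔ j hj]; positivity) heq
  -- Replacing `empCov a` by `T` moves `(empCov a - T) Δ` into the noise; its factor `l ^ 2` absorbs
  -- the `1 / l` of the crude bound and leaves a spare `l`.
  have hb : ‖(n : ℝ)⁻¹ • ∑ i, ε i • a i - (empCov a - T) (g - f)‖ ≤ r := by
    refine (norm_sub_le _ _).trans (le_trans (add_le_add hε ?_) hr)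
    refine ((empCov a - T).le_opNorm _).trans ?_
    calc ‖empCov a - T‖ * ‖g - f‖ ≤ l ^ 2 * ‖g - f‖ := by gcongr
      _ = l * (l * ‖g - f‖) := by ring
      _ ≤ _ := by gcongr
  have heq' : T (g - f) + l • (g - f) =
      ((n : ℝ)⁻¹ • ∑ i, ε i • a i - (empCov a - T) (g - f)) - enetScore l a u g - l • f := by
    rw [_root_.sub_apply, eq_sub_of_add_eq heq]
    abel
  have hzero : ∀ j, j ∉ S → (g - f) j = 0 := fun j hj =>
    error_eq_zero_of_notMem hsymm hpos hl hL hκ hq hb hf hfS hqΔ heq' hslack hj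
  exact ⟨fun j hj => (hΔ j hj).symm.trans (hzero j hj),
    fun j => norm_diagBlock_error_le hpos hl hL hq hb hf hzero heq' j⟩

end Stationarity

/-! ### Second moments and Chebyshev's inequality in Hilbert spaces. -/

section Moments

variable {E Ω H : Type*} [MeasurableSpace E] [MeasurableSpace Ω] [NormedAddCommGroup H]
  [InnerProductSpace ℝ H]

lemma integrable_inner_of_memLp_two {μ : Measure Ω} {a b : Ω → H} (ha : MemLp a 2 μ)
    (hb : MemLp b 2 μ) : Integrable (fun ω => inner ℝ (a ω) (b ω)) μ := by
  refine ((ha.integrable_norm_pow two_ne_zero).add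
    (hb.integrable_norm_pow two_ne_zero)).mono' (ha.1.inner hb.1) (ae_of_all _ fun ω => ?_)
  refine (abs_real_inner_le_norm _ _).trans ?_
  simp only [Pi.add_apply]
  nlinarith [sq_nonneg (‖a ω‖ - ‖b ω‖), sq_nonneg ‖a ω‖, sq_nonneg ‖b ω‖]

variable [CompleteSpace H] {P : Measure E} {μ : Measure Ω} [IsProbabilityMeasure μ] {n : ℕ}
  {Z : Fin n → Ω → E} {ξ : E → H}

/-- The sum of `n` i.i.d. centred square-integrable Hilbert-space-valued variables has second
moment `n` times that of a single one. -/
lemma integral_norm_sum_sq_iid [IsProbabilityMeasure P] (hZ : ∀ i, Measurable (Z i))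
    (hlaw : ∀ i, μ.map (Z i) = P) (hindep : iIndepFun Z μ) (hξ : MemLp ξ 2 P)
    (hmean : ∫ z, ξ z ∂P = 0) :
    Integrable (fun ω => ‖∑ i, ξ (Z i ω)‖ ^ 2) μ ∧
      ∫ ω, ‖∑ i, ξ (Z i ω)‖ ^ 2 ∂μ = n * ∫ z, ‖ξ z‖ ^ 2 ∂P := by
  have hmp : ∀ i, MeasurePreserving (Z i) μ P := fun i => ⟨hZ i, hlaw i⟩
  have hL2 : ∀ i, MemLp (fun ω => ξ (Z i ω)) 2 μ := fun i => hξ.comp_measurePreserving (hmp i)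
  have hint : ∀ i k, Integrable (fun ω => inner ℝ (ξ (Z i ω)) (ξ (Z k ω))) μ := fun i k =>
    integrable_inner_of_memLp_two (hL2 i) (hL2 k)
  have hexp : ∀ ω, ‖∑ i, ξ (Z i ω)‖ ^ 2 =
      ∑ i, ∑ k, inner ℝ (ξ (Z i ω)) (ξ (Z k ω)) := fun ω => by
    rw [← real_inner_self_eq_norm_sq, sum_inner]
    simp only [inner_sum]
  -- Independence and centring annihilate the cross terms.
  have hoff : ∀ i k, i ≠ k → ∫ ω, inner ℝ (ξ (Z i ω)) (ξ (Z k ω)) ∂μ = 0 := by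
    intro i k hik
    have hξ1 : ∀ i, Integrable ξ (μ.map (Z i)) := fun i => by
      rw [hlaw i]; exact hξ.integrable one_le_two
    have h := (hindep.indepFun hik).integral_bilin_comp_comp (hZ i).aemeasurable
      (hZ k).aemeasurable (hξ1 i) (hξ1 k) (innerSL ℝ : H →L[ℝ] H →L[ℝ] ℝ)
    have h0 : ∫ ω, ξ (Z i ω) ∂μ = 0 := by
      rw [← integral_map (hZ i).aemeasurable (hξ1 i).1, hlaw, hmean]
    rw [h0, map_zero] at h
    exact h
  have hdiag : ∀ i, ∫ ω, inner ℝ (ξ (Z i ω)) (ξ (Z i ω)) ∂μ = ∫ z, ‖ξ z‖ ^ 2 ∂P := by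
    intro i
    simp only [real_inner_self_eq_norm_sq]
    rw [← hlaw i, integral_map (hZ i).aemeasurable]
    rw [hlaw i]
    exact (hξ.1.norm.pow 2)
  simp only [hexp]
  refine ⟨integrable_finsetSum _ fun i _ => integrable_finsetSum _ fun k _ => hint i k, ?_⟩
  rw [integral_finsetSum _ fun i _ => integrable_finsetSum _ fun k _ => hint i k]
  simp only [integral_finsetSum _ fun k _ => hint _ k]
  rw [Finset.sum_congr rfl fun i _ => Finset.sum_eq_single i
    (fun k _ hki => hoff i k hki.symm) (by simp)]
  simp only [hdiag]
  simp

/-- Chebyshev's inequality for the mean of i.i.d. centred Hilbert-space-valued variables. -/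
lemma measure_lt_norm_mean_iid_le [IsProbabilityMeasure P] (hZ : ∀ i, Measurable (Z i))
    (hlaw : ∀ i, μ.map (Z i) = P) (hindep : iIndepFun Z μ) (hξ : MemLp ξ 2 P)
    (hmean : ∫ z, ξ z ∂P = 0) {K : ℝ} (hK : ∫ z, ‖ξ z‖ ^ 2 ∂P ≤ K) {t : ℝ} (ht : 0 < t) :
    μ {ω | t < ‖(n : ℝ)⁻¹ • ∑ i, ξ (Z i ω)‖} ≤ ENNReal.ofReal (K / (n * t ^ 2)) := by
  obtain ⟨hint, heq⟩ := integral_norm_sum_sq_iid hZ hlaw hindep hξ hmean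
  rcases Nat.eq_zero_or_pos n with rfl | hn
  · have : {ω : Ω | t < ‖((0 : ℕ) : ℝ)⁻¹ • ∑ i, ξ (Z i ω)‖} = ∅ := by
      ext ω; simp [ht.le]
    rw [this]; simp
  have hn' : (0 : ℝ) < n := by exact_mod_cast hn
  have hsub : {ω | t < ‖(n : ℝ)⁻¹ • ∑ i, ξ (Z i ω)‖} ⊆
      {ω | (n * t) ^ 2 ≤ ‖∑ i, ξ (Z i ω)‖ ^ 2} := by
    intro ω hω
    simp only [Set.mem_ofPred_eq, norm_smul, norm_inv, RCLike.norm_natCast] at hω ⊢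
    rw [lt_inv_mul_iff₀ hn'] at hω
    gcongr
  refine (measure_mono hsub).trans ?_
  have hmarkov := mul_meas_ge_le_integral_of_nonneg (ae_of_all μ fun ω => sq_nonneg _) hint
    ((n * t) ^ 2)
  rw [heq] at hmarkov
  rw [ENNReal.le_ofReal_iff_toReal_le (measure_ne_top _ _)
    (div_nonneg ((integral_nonneg fun _ => sq_nonneg _).trans hK) (by positivity)),
    le_div_iff₀ (by positivity)]
  change (n * t) ^ 2 * (μ {ω | (n * t) ^ 2 ≤ ‖∑ i, ξ (Z i ω)‖ ^ 2}).toReal ≤ _ at hmarkov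
  have h2 : n * ∫ z, ‖ξ z‖ ^ 2 ∂P ≤ n * K := by gcongr
  refine le_of_mul_le_mul_left ?_ hn'
  linarith

end Moments

/-! ### Tensor squares, a Hilbert-space home for covariance deviations. -/

section TensorSquare

open TensorProduct

variable {H : Type*} [NormedAddCommGroup H] [InnerProductSpace ℝ H]

/-- The elementary tensor `x ⊗ y` in the completed Hilbert tensor product. -/
def hilbertTmul (x y : H) : UniformSpace.Completion (H ⊗[ℝ] H) := ((x ⊗ₜ[ℝ] y : H ⊗[ℝ] H) :)

lemma inner_hilbertTmul (x y a b : H) :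
    inner ℝ (hilbertTmul x y) (hilbertTmul a b) = inner ℝ x a * inner ℝ y b := by
  simp [hilbertTmul, UniformSpace.Completion.inner_coe]

lemma norm_hilbertTmul (x y : H) : ‖hilbertTmul x y‖ = ‖x‖ * ‖y‖ := by
  simp [hilbertTmul]

lemma continuous_hilbertTmul_self : Continuous fun x : H => hilbertTmul x x :=
  (UniformSpace.Completion.continuous_coe _).comp
    (TensorProduct.continuous_tmul.comp (continuous_id.prodMk continuous_id))

end TensorSquare

lemma continuous_rankOne_self {H : Type*} [NormedAddCommGroup H] [InnerProductSpace ℝ H] :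
    Continuous fun v : H => InnerProductSpace.rankOne ℝ v v :=
  (InnerProductSpace.rankOne ℝ : H →L[ℝ] H →L⋆[ℝ] H →L[ℝ] H).continuous₂.comp
    (continuous_id.prodMk continuous_id)

/-! ### The covariance operator and concentration in the additive model. -/

section Model

variable {ι : Type*} [Fintype ι] {𝒳 : ι → Type*} {M : ι → Type*} {𝒴 : Type*}
  [∀ j, NormedAddCommGroup (M j)] [∀ j, InnerProductSpace ℝ (M j)] [∀ j, CompleteSpace (M j)]
  [∀ j, RKHS ℝ (M j) (𝒳 j) ℝ] {B : ℝ}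

lemma inner_feature (x : ∀ j, 𝒳 j) (g : PiLp 2 M) :
    inner ℝ (feature M x) g = ∑ j, (g j) (x j) := by
  rw [PiLp.inner_apply]
  refine Finset.sum_congr rfl fun j _ => ?_
  simp [feature]

lemma norm_feature_sq_le (hB : ∀ j (x : 𝒳 j), ‖RKHS.kerFun (M j) x (1 : ℝ)‖ ≤ B)
    (x : ∀ j, 𝒳 j) : ‖feature M x‖ ^ 2 ≤ Fintype.card ι * B ^ 2 := by
  rw [PiLp.norm_sq_eq_of_L2]
  calc ∑ j, ‖feature M x j‖ ^ 2 ≤ ∑ _j : ι, B ^ 2 := by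
        gcongr with j
        exact hB j (x j)
    _ = _ := by simp

lemma enetObjective_eq_enetLoss [MetricSpace 𝒴] {n : ℕ} (y y₀ : 𝒴) (L l : ℝ)
    (z : Fin n → (∀ j, 𝒳 j) × 𝒴) (g : PiLp 2 M) :
    enetObjective y y₀ L l z g = enetLoss L l (fun i => feature M (z i).1)
      (fun i => response y y₀ (z i).2) g := by
  simp only [enetObjective, enetLoss, inner_feature]

lemma response_eq_add_modelError [MetricSpace 𝒴] (y y₀ : 𝒴) (f : PiLp 2 M)
    (z : (∀ j, 𝒳 j) × 𝒴) :
    response y y₀ z.2 = inner ℝ (feature M z.1) f + modelError y y₀ f z := by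
  rw [inner_feature, modelError]
  ring

variable [∀ j, MeasurableSpace (𝒳 j)] {ν : Measure (∀ j, 𝒳 j)}

lemma integrable_rankOne_feature [IsFiniteMeasure ν] (hν : AEStronglyMeasurable (feature M) ν)
    (hB : ∀ j (x : 𝒳 j), ‖RKHS.kerFun (M j) x (1 : ℝ)‖ ≤ B) :
    Integrable (fun x => InnerProductSpace.rankOne ℝ (feature M x) (feature M x)) ν := by
  refine Integrable.of_bound (continuous_rankOne_self.comp_aestronglyMeasurable hν) (Fintype.card ι * B ^ 2)
    (ae_of_all _ fun x => ?_)
  rw [InnerProductSpace.norm_rankOne, ← sq]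
  exact norm_feature_sq_le hB x

lemma inner_covOp [IsFiniteMeasure ν] (hν : AEStronglyMeasurable (feature M) ν)
    (hB : ∀ j (x : 𝒳 j), ‖RKHS.kerFun (M j) x (1 : ℝ)‖ ≤ B) (u v : PiLp 2 M) :
    inner ℝ u (covOp M ν v) =
      ∫ x, inner ℝ (feature M x) u * inner ℝ (feature M x) v ∂ν := by
  have hint := integrable_rankOne_feature hν hB
  rw [covOp, ContinuousLinearMap.integral_apply hint,
    ← integral_inner (hint.apply_continuousLinearMap v)]
  refine integral_congr_ae (ae_of_all _ fun x => ?_)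
  simp only [InnerProductSpace.rankOne_apply, real_inner_smul_right]
  rw [real_inner_comm u, mul_comm]

lemma covOp_symm [IsFiniteMeasure ν] (hν : AEStronglyMeasurable (feature M) ν)
    (hB : ∀ j (x : 𝒳 j), ‖RKHS.kerFun (M j) x (1 : ℝ)‖ ≤ B) (u v : PiLp 2 M) :
    inner ℝ (covOp M ν u) v = inner ℝ u (covOp M ν v) := by
  rw [real_inner_comm, inner_covOp hν hB, inner_covOp hν hB]
  simp only [mul_comm]

lemma inner_covOp_self_nonneg [IsFiniteMeasure ν] (hν : AEStronglyMeasurable (feature M) ν)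
    (hB : ∀ j (x : 𝒳 j), ‖RKHS.kerFun (M j) x (1 : ℝ)‖ ≤ B) (u : PiLp 2 M) :
    0 ≤ inner ℝ (covOp M ν u) u := by
  rw [real_inner_comm, inner_covOp hν hB]
  exact integral_nonneg fun x => mul_self_nonneg _

/-- By the reproducing property, the signal strength `E[f_j²]` is a quadratic form of `Σ_jj`. -/
lemma inner_diagBlock_covOp_self [IsFiniteMeasure ν] (hν : AEStronglyMeasurable (feature M) ν)
    (hB : ∀ j (x : 𝒳 j), ‖RKHS.kerFun (M j) x (1 : ℝ)‖ ≤ B) (j : ι) (g : M j) :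
    inner ℝ g (diagBlock (covOp M ν) j g) = ∫ x, g (x j) ^ 2 ∂ν := by
  classical
  rw [inner_diagBlock, inner_covOp hν hB]
  refine integral_congr_ae (ae_of_all _ fun x => ?_)
  have h : inner ℝ (feature M x) (WithLp.toLp 2 (Pi.single j g)) = g (x j) := by
    rw [inner_feature, Finset.sum_eq_single j]
    · simp
    · intro k _ hk
      simp [Pi.single_eq_of_ne hk]
    · simp
  simp only [h, sq]

variable [MeasurableSpace 𝒴] {P : Measure ((∀ j, 𝒳 j) × 𝒴)} [IsProbabilityMeasure P]

lemma aestronglyMeasurable_feature_fst (hν : AEStronglyMeasurable (feature M) P.fst) :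
    AEStronglyMeasurable (fun z => feature M z.1) P :=
  hν.comp_measurable measurable_fst

lemma memLp_noise_smul_feature (hν : AEStronglyMeasurable (feature M) P.fst)
    (hB : ∀ j (x : 𝒳 j), ‖RKHS.kerFun (M j) x (1 : ℝ)‖ ≤ B) {ε : (∀ j, 𝒳 j) × 𝒴 → ℝ}
    (hε : MemLp ε 2 P) : MemLp (fun z => ε z • feature M z.1) 2 P := by
  refine MemLp.of_le_mul (c := √(Fintype.card ι * B ^ 2)) hε
    (hε.1.smul (aestronglyMeasurable_feature_fst hν)) (ae_of_all _ fun z => ?_)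
  rw [norm_smul, mul_comm]
  gcongr
  exact Real.le_sqrt_of_sq_le (norm_feature_sq_le hB z.1)

lemma integral_noise_smul_feature
    (hν : AEStronglyMeasurable (feature M) P.fst)
    (hB : ∀ j (x : 𝒳 j), ‖RKHS.kerFun (M j) x (1 : ℝ)‖ ≤ B) {ε : (∀ j, 𝒳 j) × 𝒴 → ℝ}
    (hε : MemLp ε 2 P) (hmean : P[ε | MeasurableSpace.comap Prod.fst inferInstance] =ᵐ[P] 0) :
    ∫ z, ε z • feature M z.1 ∂P = 0 := by
  have hm : MeasurableSpace.comap (Prod.fst : (∀ j, 𝒳 j) × 𝒴 → _) inferInstance ≤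
      (inferInstance : MeasurableSpace ((∀ j, 𝒳 j) × 𝒴)) := measurable_fst.comap_le
  have hfm : AEStronglyMeasurable[MeasurableSpace.comap Prod.fst inferInstance]
      (fun z : (∀ j, 𝒳 j) × 𝒴 => feature M z.1) P := by
    -- A strongly measurable version of the feature map, composed with the projection, is measurable
    -- for the σ-field of `X`, so it pulls out of the conditional expectation.
    refine ⟨fun z => hν.mk _ z.1, ?_, ?_⟩
    · exact hν.stronglyMeasurable_mk.comp_measurable (comap_measurable Prod.fst)
    · exact ae_of_ae_map measurable_fst.aemeasurable hν.ae_eq_mk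
  have hint := (memLp_noise_smul_feature hν hB hε).integrable one_le_two
  have h := condExp_smul_of_aestronglyMeasurable_right (hε.integrable one_le_two) hint hfm
  rw [← integral_condExp hm]
  refine integral_eq_zero_of_ae (h.trans ?_)
  filter_upwards [hmean] with z hz
  simp [hz]

variable {Ω : Type*} [MeasurableSpace Ω] {μ : Measure Ω} [IsProbabilityMeasure μ] {n : ℕ}
  {Z : Fin n → Ω → (∀ j, 𝒳 j) × 𝒴}

lemma measure_lt_norm_noise_le (hZ : ∀ i, Measurable (Z i))
    (hlaw : ∀ i, μ.map (Z i) = P) (hindep : iIndepFun Z μ)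
    (hν : AEStronglyMeasurable (feature M) P.fst)
    (hB : ∀ j (x : 𝒳 j), ‖RKHS.kerFun (M j) x (1 : ℝ)‖ ≤ B) {ε : (∀ j, 𝒳 j) × 𝒴 → ℝ}
    (hε : MemLp ε 2 P) (hmean : P[ε | MeasurableSpace.comap Prod.fst inferInstance] =ᵐ[P] 0)
    (hεB : ∫ z, ε z ^ 2 ∂P ≤ B) {t : ℝ} (ht : 0 < t) :
    μ {ω | t < ‖(n : ℝ)⁻¹ • ∑ i, ε (Z i ω) • feature M (Z i ω).1‖} ≤
      ENNReal.ofReal (Fintype.card ι * B ^ 2 * B / (n * t ^ 2)) := by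
  have hL2 := memLp_noise_smul_feature hν hB hε
  refine measure_lt_norm_mean_iid_le (ξ := fun z => ε z • feature M z.1) hZ hlaw hindep hL2
    (integral_noise_smul_feature hν hB hε hmean) ?_ ht
  calc ∫ z, ‖ε z • feature M z.1‖ ^ 2 ∂P ≤ ∫ z, (Fintype.card ι * B ^ 2) * ε z ^ 2 ∂P := by
        refine integral_mono (hL2.integrable_norm_pow two_ne_zero)
          (hε.integrable_sq.const_mul _) fun z => ?_
        simp only [norm_smul, mul_pow, Real.norm_eq_abs, sq_abs]
        rw [mul_comm]
        gcongr
        exact norm_feature_sq_le hB z.1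
    _ = (Fintype.card ι * B ^ 2) * ∫ z, ε z ^ 2 ∂P := integral_const_mul _ _
    _ ≤ _ := by gcongr

/-- The operator norm is at most the Hilbert–Schmidt norm, here that of the completed tensor square,
where the second-moment Chebyshev bound applies. -/
lemma measure_lt_norm_empCov_sub_le (hn : 0 < n) (hZ : ∀ i, Measurable (Z i))
    (hlaw : ∀ i, μ.map (Z i) = P) (hindep : iIndepFun Z μ)
    (hν : AEStronglyMeasurable (feature M) P.fst)
    (hB : ∀ j (x : 𝒳 j), ‖RKHS.kerFun (M j) x (1 : ℝ)‖ ≤ B) {t : ℝ} (ht : 0 < t) :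
    μ {ω | t < ‖empCov (fun i => feature M (Z i ω).1) - covOp M P.fst‖} ≤
      ENNReal.ofReal ((2 * (Fintype.card ι * B ^ 2)) ^ 2 / (n * t ^ 2)) := by
  set K : ℝ := Fintype.card ι * B ^ 2 with hK
  set τ : (∀ j, 𝒳 j) × 𝒴 → UniformSpace.Completion (TensorProduct ℝ (PiLp 2 M) (PiLp 2 M)) :=
    fun z => hilbertTmul (feature M z.1) (feature M z.1) with hτ
  have hτmeas : AEStronglyMeasurable τ P :=
    continuous_hilbertTmul_self.comp_aestronglyMeasurable (aestronglyMeasurable_feature_fst hν)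
  have hτnorm : ∀ z, ‖τ z‖ ≤ K := fun z => by
    rw [hτ, norm_hilbertTmul, ← sq]
    exact norm_feature_sq_le hB z.1
  have hτint : Integrable τ P := Integrable.of_bound hτmeas K (ae_of_all _ hτnorm)
  set m := ∫ z, τ z ∂P with hm
  have hmnorm : ‖m‖ ≤ K := by
    refine (norm_integral_le_of_norm_le_const (ae_of_all _ hτnorm)).trans_eq ?_
    simp
  have hξnorm : ∀ z, ‖τ z - m‖ ≤ 2 * K := fun z =>
    (norm_sub_le _ _).trans (by linarith [hτnorm z])
  have hξmean : ∫ z, (τ z - m) ∂P = 0 := by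
    rw [integral_sub hτint (integrable_const m)]
    simp [hm]
  have hξL2 : MemLp (fun z => τ z - m) 2 P :=
    MemLp.of_bound (hτmeas.sub aestronglyMeasurable_const) (2 * K) (ae_of_all _ hξnorm)
  have hinner : ∀ u v : PiLp 2 M,
      inner ℝ (hilbertTmul u v) m = inner ℝ u (covOp M P.fst v) := by
    intro u v
    rw [inner_covOp hν hB, hm, ← integral_inner hτint, Measure.fst,
      integral_map measurable_fst.aemeasurable]
    · refine integral_congr_ae (ae_of_all _ fun z => ?_)
      simp only [hτ, inner_hilbertTmul]
      rw [real_inner_comm, real_inner_comm v]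
    · exact (hν.inner aestronglyMeasurable_const).mul (hν.inner aestronglyMeasurable_const)
  refine le_trans (measure_mono fun ω hω => ?_)
    (measure_lt_norm_mean_iid_le hZ hlaw hindep hξL2 hξmean (K := (2 * K) ^ 2) ?_ ht)
  · simp only [Set.mem_ofPred_eq] at hω ⊢
    refine lt_of_lt_of_le hω ?_
    refine ContinuousLinearMap.opNorm_le_bound _ (norm_nonneg _) fun v => ?_
    set D := (n : ℝ)⁻¹ • ∑ i, (τ (Z i ω) - m) with hD
    set w := (empCov (fun i => feature M (Z i ω).1) - covOp M P.fst) v with hw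
    -- The centred tensor mean `D` represents the operator deviation against elementary tensors;
    -- taking `u = w` gives `‖w‖ ≤ ‖D‖ * ‖v‖`.
    have hwD : ∀ u, inner ℝ u w = inner ℝ (hilbertTmul u v) D := by
      intro u
      have hn' : (n : ℝ) ≠ 0 := by exact_mod_cast hn.ne'
      rw [hD, Finset.sum_sub_distrib, smul_sub, inner_sub_right]
      simp only [Finset.sum_const, Finset.card_univ, Fintype.card_fin]
      rw [← Nat.cast_smul_eq_nsmul ℝ, smul_smul, inv_mul_cancel₀ hn', one_smul, hinner,
        real_inner_smul_right, inner_sum, hw, _root_.sub_apply, inner_sub_right, empCov_apply,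
        real_inner_smul_right, inner_sum]
      congr 2
      refine Finset.sum_congr rfl fun i _ => ?_
      rw [real_inner_smul_right, hτ, inner_hilbertTmul, real_inner_comm v, mul_comm]
    have h1 : ‖w‖ * ‖w‖ ≤ ‖w‖ * (‖D‖ * ‖v‖) := by
      rw [← real_inner_self_eq_norm_mul_norm, hwD]
      refine (real_inner_le_norm _ _).trans_eq ?_
      rw [norm_hilbertTmul]
      ring
    rcases (norm_nonneg w).eq_or_lt with h0 | h0
    · rw [← h0]; positivity
    · exact le_of_mul_le_mul_left h1 h0
  · calc ∫ z, ‖τ z - m‖ ^ 2 ∂P ≤ ∫ _z, (2 * K) ^ 2 ∂P := by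
          refine integral_mono (hξL2.integrable_norm_pow two_ne_zero) (integrable_const _)
            fun z => ?_
          gcongr
          exact hξnorm z
      _ = _ := by simp

end Model

lemma mem_activeSet {ι : Type*} [Fintype ι] {M : ι → Type*} [∀ j, NormedAddCommGroup (M j)]
    [∀ j, InnerProductSpace ℝ (M j)] {f : PiLp 2 M} {j : ι} :
    j ∈ activeSet f ↔ f j ≠ 0 := by
  simp [activeSet]

/-! ### Asymptotics of the tuning parameters. -/

section Rates

variable {L l : ℕ → ℝ} {γ C B₀ : ℝ}

/-- The first form feeds the irrepresentable slack; the second says `l = O(L)`, so that `l` inherits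
the decay of `L`. -/
lemma penalty_le_of_ratio {L l : ℝ} (hl : 0 < l) (hγ : 0 < γ) (hγ1 : γ < 1) (hC : 0 < C)
    (hratio : C * ((1 - γ) / γ) < L / l) :
    C * (1 - γ) * l < γ * L ∧ l ≤ γ / (C * (1 - γ)) * L := by
  have h1 : 0 < C * (1 - γ) := mul_pos hC (by linarith)
  have h2 : C * (1 - γ) * l < γ * L := by
    rw [lt_div_iff₀ hl, ← mul_div_assoc, div_mul_eq_mul_div, div_lt_iff₀ hγ] at hratio
    linarith
  refine ⟨h2, ?_⟩
  rw [div_mul_eq_mul_div, le_div_iff₀ h1]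
  linarith

lemma tendsto_ridge_zero (hl : ∀ n, 0 < l n) (hγ : 0 < γ) (hγ1 : γ < 1) (hC : 0 < C)
    (hratio : ∀ n, C * ((1 - γ) / γ) < L n / l n) (hL : Tendsto L atTop (𝓝 0)) :
    Tendsto l atTop (𝓝 0) := by
  refine squeeze_zero (fun n => (hl n).le)
    (fun n => (penalty_le_of_ratio (hl n) hγ hγ1 hC (hratio n)).2) ?_
  simpa using hL.const_mul (γ / (C * (1 - γ)))

lemma tendsto_remainder_zero (s : ℕ) (hl : Tendsto l atTop (𝓝 0)) (hL : Tendsto L atTop (𝓝 0)) :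
    Tendsto (fun n => l n + (l n ^ 2 + s * L n + l n * B₀)) atTop (𝓝 0) := by
  have h := hl.add (((hl.pow 2).add (hL.const_mul (s : ℝ))).add (hl.mul_const B₀))
  simpa using h

/-- The irrepresentable slack dominates the stochastic remainder. -/
lemma slack_of_remainder_le {L l ρ : ℝ} (hl : 0 < l) (hγ : 0 < γ)
    (hρ0 : 0 ≤ ρ) (hpen : C * (1 - γ) * l < γ * L) (hρ : 2 * ρ ≤ (1 - γ) * (C - B₀)) :
    l * ρ + (1 - γ) * (l * ρ + L + l * B₀) < L := by
  have h1 : 2 * ρ * l ≤ (1 - γ) * (C - B₀) * l := by gcongr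
  have h2 : 0 ≤ γ * (l * ρ) := by positivity
  nlinarith

/-- Since `l = O(L)`, the whole score bound is `O(L)`, and `L n * N n → 0` finishes. -/
lemma tendsto_error_bound_zero (hl : ∀ n, 0 < l n) (hLpos : ∀ n, 0 < L n) (hγ : 0 < γ)
    (hγ1 : γ < 1) (hC : 0 < C) (hB₀ : 0 ≤ B₀)
    (hratio : ∀ n, C * ((1 - γ) / γ) < L n / l n) {ρ N : ℕ → ℝ} (hρ : Tendsto ρ atTop (𝓝 0))
    (hρ0 : ∀ n, 0 ≤ ρ n) (hN : ∀ n, 0 ≤ N n) (hLN : Tendsto (fun n => L n * N n) atTop (𝓝 0)) :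
    Tendsto (fun n => N n * (l n * ρ n + L n + l n * B₀)) atTop (𝓝 0) := by
  set A := γ / (C * (1 - γ)) with hA
  have hlim : Tendsto (fun n => L n * N n * (A * ρ n + 1 + A * B₀)) atTop (𝓝 0) := by
    have h := hLN.mul (((hρ.const_mul A).add_const 1).add_const (A * B₀))
    simpa using h
  refine squeeze_zero (fun n => ?_) (fun n => ?_) hlim
  · have := hl n; have := hLpos n; have := hρ0 n; have := hN n
    positivity
  · have h := (penalty_le_of_ratio (hl n) hγ hγ1 hC (hratio n)).2
    rw [← hA] at h
    have h1 := mul_le_mul_of_nonneg_right h (hρ0 n)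
    have h2 := mul_le_mul_of_nonneg_right h hB₀
    calc N n * (l n * ρ n + L n + l n * B₀)
        ≤ N n * (A * L n * ρ n + L n + A * L n * B₀) := by
          gcongr
          exact hN n
      _ = _ := by ring

lemma inv_rate_sq {n p : ℕ} {l : ℝ} :
    (√(n : ℝ) * l ^ 2 / (p : ℝ))⁻¹ ^ 2 = (p : ℝ) ^ 2 / (n * (l ^ 2) ^ 2) := by
  rw [inv_div, div_pow, mul_pow, Real.sq_sqrt (Nat.cast_nonneg n)]

end Rates

end FrechetEnet

end

/-! ### Assembly of the theorem. -/

open FrechetEnet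

theorem theorem4
    -- for each sample size `n`: covariate spaces, their RKHSs, and the response space
    {p : ℕ → ℕ}
    {𝒳 : (n : ℕ) → Fin (p n) → Type*} [∀ n j, MetricSpace (𝒳 n j)]
    [∀ n j, TopologicalSpace.SeparableSpace (𝒳 n j)]
    [∀ n j, MeasurableSpace (𝒳 n j)] [∀ n j, BorelSpace (𝒳 n j)]
    {M : (n : ℕ) → Fin (p n) → Type*} [∀ n j, NormedAddCommGroup (M n j)]
    [∀ n j, InnerProductSpace ℝ (M n j)] [∀ n j, CompleteSpace (M n j)]
    [∀ n j, RKHS ℝ (M n j) (𝒳 n j) ℝ]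
    {𝒴 : ℕ → Type*} [∀ n, MetricSpace (𝒴 n)] [∀ n, MeasurableSpace (𝒴 n)]
    [∀ n, BorelSpace (𝒴 n)]
    -- the law of `(X, Y)` and an i.i.d. sample of size `n` from it
    (P : (n : ℕ) → Measure ((∀ j, 𝒳 n j) × 𝒴 n)) [∀ n, IsProbabilityMeasure (P n)]
    {Ω : ℕ → Type*} [∀ n, MeasurableSpace (Ω n)]
    (μ : (n : ℕ) → Measure (Ω n)) [∀ n, IsProbabilityMeasure (μ n)]
    (Z : (n : ℕ) → Fin n → Ω n → (∀ j, 𝒳 n j) × 𝒴 n)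
    (hZ_meas : ∀ n i, Measurable (Z n i))
    (hZ_law : ∀ n i, (μ n).map (Z n i) = P n)
    (hZ_indep : ∀ n, iIndepFun (Z n) (μ n))
    -- measurability of the feature map
    (h_feature : ∀ n, AEStronglyMeasurable (feature (M n)) (P n).fst)
    -- the additive model `d²(Y, y) - d²(Y, y₀) = ∑ f_j(X_j) + ε`, `E[ε | X] = 0`
    (y y₀ : (n : ℕ) → 𝒴 n) (f : (n : ℕ) → PiLp 2 (M n))
    (h_noise_L2 : ∀ n, MemLp (modelError (y n) (y₀ n) (f n)) 2 (P n))
    (h_noise_mean : ∀ n, (P n)[modelError (y n) (y₀ n) (f n) |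
      MeasurableSpace.comap Prod.fst inferInstance] =ᵐ[P n] 0)
    -- the tuning parameters and the elastic-net estimator
    (lam₁ lam₂ : ℕ → ℝ) (h_lam₁_pos : ∀ n, 0 < lam₁ n) (h_lam₂_pos : ∀ n, 0 < lam₂ n)
    (fhat : (n : ℕ) → Ω n → PiLp 2 (M n))
    (h_fhat : ∀ n ω (g : PiLp 2 (M n)),
      enetObjective (y n) (y₀ n) (lam₁ n) (lam₂ n) (fun i => Z n i ω) (fhat n ω) ≤
        enetObjective (y n) (y₀ n) (lam₁ n) (lam₂ n) (fun i => Z n i ω) g)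
    -- irrepresentable condition
    (γ : ℝ) (hγ : 0 < γ)
    (h_irrep : ∀ n, normInfInf
      (subOp (covOp (M n) (P n).fst) (activeSet (f n))ᶜ (activeSet (f n)) ∘L
        regInverse (covOp (M n) (P n).fst) (activeSet (f n)) (lam₂ n)) < 1 - γ)
    -- scaling of the tuning parameters
    (C : ℝ) (hC : 1 < C)
    (h_ratio : ∀ n, C * ((1 - γ) / γ) < lam₁ n / lam₂ n)
    (h_lam₂ : Tendsto (fun n : ℕ => √(n : ℝ) * lam₂ n ^ 2 / (p n : ℝ)) atTop atTop)
    (h_lam₁ : Tendsto lam₁ atTop (𝓝 0))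
    -- boundedness: kernels, signal norm (`sup_n ‖f_n‖ < C`), noise variance
    (B : ℝ) (h_kernel : ∀ n j (x : 𝒳 n j), ‖RKHS.kerFun (M n j) x (1 : ℝ)‖ ≤ B)
    (B₀ : ℝ) (hB₀ : B₀ < C) (h_signal : ∀ n, ‖f n‖ ≤ B₀)
    (h_noise : ∀ n, ∫ z, modelError (y n) (y₀ n) (f n) z ^ 2 ∂(P n) ≤ B)
    -- dimensionality
    (h_dim : (fun n => (p n : ℝ)) =o[atTop] fun n : ℕ => √(n : ℝ))
    (s : ℕ) (h_card : ∀ n, (activeSet (f n)).card ≤ s)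
    -- signal strength on the active set
    (c : ℝ) (hc : 0 < c)
    (h_strength : ∀ n, ∀ j ∈ activeSet (f n), c < ∫ x, (f n j) (x j) ^ 2 ∂(P n).fst)
    -- regularization scaling
    (h_reg : Tendsto (fun n => lam₁ n * normInfInf
      (diagOp (covOp (M n) (P n).fst) (activeSet (f n)) ∘L
        regInverse (covOp (M n) (P n).fst) (activeSet (f n)) (lam₂ n))) atTop (𝓝 0)) :
    Tendsto (fun n => μ n {ω | activeSet (fhat n ω) = activeSet (f n)}) atTop (𝓝 1) ∧
    ∀ δ : ℝ, 0 < δ → Tendsto (fun n => μ n {ω | δ ≤ ⨆ j : activeSet (f n),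
      ‖diagBlock (covOp (M n) (P n).fst) j (fhat n ω j - f n j)‖}) atTop (𝓝 0) := by
  have hγ1 : γ < 1 := by
    have := (normInfInf_nonneg _).trans_lt (h_irrep 0)
    linarith
  have hC0 : 0 < C := one_pos.trans hC
  have hB₀0 : 0 ≤ B₀ := (norm_nonneg _).trans (h_signal 0)
  have hB : 0 ≤ B := (integral_nonneg fun _ => sq_nonneg _).trans (h_noise 0)
  have hsymm := fun n => covOp_symm (h_feature n) (h_kernel n)
  have hpos := fun n => inner_covOp_self_nonneg (h_feature n) (h_kernel n)
  have hlam₂0 : Tendsto lam₂ atTop (𝓝 0) :=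
    tendsto_ridge_zero h_lam₂_pos hγ hγ1 hC0 h_ratio h_lam₁
  -- `lam₂ n * ρ n` is exactly the remainder `r` allowed by `enet_recovery`.
  set ρ : ℕ → ℝ := fun n => lam₂ n + (lam₂ n ^ 2 + s * lam₁ n + lam₂ n * B₀) with hρ
  have hρlim : Tendsto ρ atTop (𝓝 0) := tendsto_remainder_zero s hlam₂0 h_lam₁
  have hρ0 : ∀ n, 0 ≤ ρ n := fun n => by
    have := h_lam₁_pos n; have := h_lam₂_pos n
    simp only [hρ]
    positivity
  set N : ℕ → ℝ := fun n => normInfInf (diagOp (covOp (M n) (P n).fst) (activeSet (f n)) ∘L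
    regInverse (covOp (M n) (P n).fst) (activeSet (f n)) (lam₂ n)) with hN
  set K : ℕ → ℝ := fun n => N n * (lam₂ n * ρ n + lam₁ n + lam₂ n * B₀) with hK
  have hKlim : Tendsto K atTop (𝓝 0) :=
    tendsto_error_bound_zero h_lam₂_pos h_lam₁_pos hγ hγ1 hC0 hB₀0 h_ratio hρlim hρ0
      (fun n => normInfInf_nonneg _) h_reg
  -- the event on which the noise or the empirical covariance deviates
  set bad : (n : ℕ) → Set (Ω n) := fun n =>
    {ω | lam₂ n ^ 2 < ‖(n : ℝ)⁻¹ • ∑ i, modelError (y n) (y₀ n) (f n) (Z n i ω) •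
      feature (M n) (Z n i ω).1‖} ∪
    {ω | lam₂ n ^ 2 < ‖empCov (fun i => feature (M n) (Z n i ω).1) - covOp (M n) (P n).fst‖}
    with hbad
  have hbadlim : Tendsto (fun n => μ n (bad n)) atTop (𝓝 0) := by
    have hrate : Tendsto (fun n : ℕ => ENNReal.ofReal ((B ^ 2 * B + 4 * B ^ 4) *
        (√(n : ℝ) * lam₂ n ^ 2 / (p n : ℝ))⁻¹ ^ 2)) atTop (𝓝 0) := by
      have h := ((tendsto_inv_atTop_zero.comp h_lam₂).pow 2).const_mul (B ^ 2 * B + 4 * B ^ 4)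
      have h' := ENNReal.tendsto_ofReal h
      simpa using h'
    refine tendsto_of_tendsto_of_tendsto_of_le_of_le' tendsto_const_nhds hrate
      (Eventually.of_forall fun _ => zero_le) ?_
    filter_upwards [eventually_gt_atTop 0] with n hn
    have ht : 0 < lam₂ n ^ 2 := pow_pos (h_lam₂_pos n) 2
    have h1 := measure_lt_norm_noise_le (hZ_meas n) (hZ_law n) (hZ_indep n) (h_feature n)
      (h_kernel n) (h_noise_L2 n) (h_noise_mean n) (h_noise n) ht
    have h2 := measure_lt_norm_empCov_sub_le hn (hZ_meas n) (hZ_law n) (hZ_indep n)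
      (h_feature n) (h_kernel n) ht
    refine (measure_union_le _ _).trans ((add_le_add h1 h2).trans ?_)
    rw [← ENNReal.ofReal_add (by positivity) (by positivity), inv_rate_sq, Fintype.card_fin]
    refine ENNReal.ofReal_le_ofReal ?_
    rw [← add_div, ← mul_div_assoc]
    gcongr
    -- The noise bound is linear in `p`, the covariance bound quadratic; the latter sets the rate.
    have hp : (p n : ℝ) ≤ (p n : ℝ) ^ 2 := by exact_mod_cast Nat.le_self_pow two_ne_zero _
    have hp' := mul_le_mul_of_nonneg_left hp (by positivity : 0 ≤ B ^ 2 * B)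
    linarith
  have hgood : ∀ᶠ n in atTop, ∀ ω, ω ∉ bad n →
      (∀ j, j ∉ activeSet (f n) → fhat n ω j = 0) ∧
      ∀ j : activeSet (f n),
        ‖diagBlock (covOp (M n) (P n).fst) j (fhat n ω j - f n j)‖ ≤ K n := by
    have hev : ∀ᶠ n in atTop, 2 * ρ n < (1 - γ) * (C - B₀) := by
      have h := hρlim.const_mul 2
      rw [mul_zero] at h
      exact h.eventually_lt_const (mul_pos (by linarith) (by linarith))
    filter_upwards [hev] with n hn ω hω
    simp only [hbad, Set.mem_union, Set.mem_ofPred_eq, not_or, not_lt] at hω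
    have hslack := slack_of_remainder_le (h_lam₂_pos n) hγ (hρ0 n)
      (penalty_le_of_ratio (h_lam₂_pos n) hγ hγ1 hC0 (h_ratio n)).1 hn.le
    refine enet_recovery (hsymm n) (hpos n) (h_card n) (h_lam₂_pos n) (h_lam₁_pos n).le
      (h_irrep n).le (h_signal n) (fun j hj => by simpa [mem_activeSet] using hj)
      (fun i => response_eq_add_modelError (y n) (y₀ n) (f n) (Z n i ω)) (fun g => ?_)
      hω.1 hω.2 (le_of_eq ?_) hslack
    · have := h_fhat n ω g
      rwa [enetObjective_eq_enetLoss, enetObjective_eq_enetLoss] at this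
    · simp only [hρ]
      ring
  constructor
  · have hlow : Tendsto (fun n => 1 - μ n (bad n)) atTop (𝓝 1) := by
      have h := ENNReal.Tendsto.sub (tendsto_const_nhds (x := (1 : ENNReal))) hbadlim
        (Or.inl ENNReal.one_ne_top)
      simpa using h
    refine tendsto_of_tendsto_of_tendsto_of_le_of_le' hlow tendsto_const_nhds ?_
      (Eventually.of_forall fun n => prob_le_one)
    -- The threshold `c / C` comes from `c < ⟨f_j, Σ_jj f_j⟩ ≤ C * K n` for a missed active
    -- component.
    filter_upwards [hgood, hKlim.eventually_lt_const (div_pos hc hC0)] with n hn hKn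
    -- Subadditivity replaces passing to complements, as the recovery event need not be measurable.
    rw [tsub_le_iff_right, ← measure_univ (μ := μ n)]
    refine (measure_mono fun ω _ => ?_).trans (measure_union_le _ _)
    by_cases hω : ω ∈ bad n
    · exact Or.inr hω
    refine Or.inl ?_
    obtain ⟨h1, h2⟩ := hn ω hω
    rw [Set.mem_ofPred_eq]
    ext j
    refine ⟨fun hj => ?_, fun hj => ?_⟩
    · by_contra hj'
      exact mem_activeSet.1 hj (h1 j hj')
    · rw [mem_activeSet]
      intro h0
      have h3 := h2 ⟨j, hj⟩
      simp only [h0, zero_sub, map_neg, norm_neg] at h3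
      have h4 := h_strength n j hj
      rw [← inner_diagBlock_covOp_self (h_feature n) (h_kernel n)] at h4
      have h5 : ‖f n j‖ ≤ C := ((PiLp.norm_apply_le _ j).trans (h_signal n)).trans hB₀.le
      have h6 : C * K n < c := by rwa [lt_div_iff₀' hC0] at hKn
      have h7 := (real_inner_le_norm _ _).trans
        (mul_le_mul h5 h3 (norm_nonneg (diagBlock (covOp (M n) (P n).fst) j (f n j))) hC0.le)
      linarith
  · intro δ hδ
    refine tendsto_of_tendsto_of_tendsto_of_le_of_le' tendsto_const_nhds hbadlim
      (Eventually.of_forall fun _ => zero_le) ?_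
    filter_upwards [hgood, hKlim.eventually_lt_const hδ] with n hn hKn
    refine measure_mono fun ω hω => ?_
    by_contra hω'
    rw [Set.mem_ofPred_eq] at hω
    -- Nonnegativity covers an empty active set, where the real supremum is `0`.
    have hK0 : 0 ≤ K n := by
      have := h_lam₁_pos n; have := h_lam₂_pos n; have := hρ0 n
      exact mul_nonneg (normInfInf_nonneg _) (by positivity)
    have := Real.iSup_le (hn ω hω').2 hK0
    linarith
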